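/- Let $\mathscr A$ be a complex unital C*-algebra with $1\neq 0$, and let $\mathscr E$ be a (right) Hilbert C*-module over $\mathscr A$, with $\mathscr A$-valued inner product $\langle\cdot|\cdot\rangle$ (conjugate linear in the first variable, linear in the second, $\langle x|ya\rangle=\langle x|y\rangle a$) and norm $\|x\|=\|\langle x|x\rangle\|^{1/2}$. Let $e\in\mathscr E$ and let $\mathscr F$ be a complex linear subspace of $\mathscr E$. Say that $e$ is Birkhoff–James orthogonal to $\mathscr F$ if $\|e\|\le\|e+kf\|$ for all $f\in\mathscr F$ and all $k\in\mathbb C$, and call a linear functional $\phi:\mathscr A\to\mathbb C$ a state if $\phi(1)=1$ and $\phi(a)$ is a non-negative real number for every positive $a\in\mathscr A$. Then $e$ is Birkhoff–James orthogonal to $\mathscr F$ if and only if there exists a state $\phi$ on $\mathscr A$ such that $\phi(\langle e|e\rangle)=\|e\|^2$ and $\phi(\langle e|f\rangle)=0$ for all $f\in\mathscr F$. -/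

import Mathlib

open scoped ComplexOrder

/-- In a normed space over `𝕜`, `v` is Birkhoff-James orthogonal to `u` if `‖v‖ ≤ ‖v + k u‖` for
every scalar `k`. -/
def IsBirkhoffJamesOrthogonal (𝕜 : Type*) {V : Type*} [NormedField 𝕜] [NormedAddCommGroup V]
    [NormedSpace 𝕜 V] (v u : V) : Prop :=
  ∀ k : 𝕜, ‖v‖ ≤ ‖v + k • u‖

/-- `v` is Birkhoff-James orthogonal to a subspace `W` if it is Birkhoff-James orthogonal to every
element of `W`. -/
def IsBirkhoffJamesOrthogonalTo {𝕜 V : Type*} [NormedField 𝕜] [NormedAddCommGroup V]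
    [NormedSpace 𝕜 V] (v : V) (W : Submodule 𝕜 V) : Prop :=
  ∀ w ∈ W, IsBirkhoffJamesOrthogonal 𝕜 v w

/-- The set of states of a unital complex C⋆-algebra: the linear functionals that take `1` to `1`
and positive elements to non-negative real numbers (`0 ≤ z` in `ℂ` means that `z` is real and
non-negative). -/
def stateSet (A : Type*) [CStarAlgebra A] [PartialOrder A] : Set (A →ₗ[ℂ] ℂ) :=
  {φ | φ 1 = 1 ∧ ∀ a : A, 0 ≤ a → 0 ≤ φ a}

/-- The `A`-valued inner product `⟨x | y⟩` of a right Hilbert C⋆-module over `A`.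

Mathlib's `CStarModule B E` asks for `⟪x, b • y⟫ = b * ⟪x, y⟫`, so a right Hilbert C⋆-module over
`A` is a `CStarModule` over the opposite algebra `Aᵐᵒᵖ`, whose scalars act on `E` from the right:
with `y a := MulOpposite.op a • y` the product below satisfies `⟨x | y a⟩ = ⟨x | y⟩ a`. It is
linear in `y`, conjugate linear in `x`, and on `A` itself it is `star x * y`. -/
def rightInner (A : Type*) {E : Type*} [Inner Aᵐᵒᵖ E] (x y : E) : A :=
  MulOpposite.unop (inner Aᵐᵒᵖ x y)

/-!
For a state `φ` with `φ ⟨e | e⟩ = ‖e‖ ^ 2` and `0 ≤ re (φ ⟨e | f⟩)`, expanding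
`re (φ ⟨e + f | e + f⟩) ≤ ‖e + f‖ ^ 2` gives `‖e‖ ≤ ‖e + f‖`.

Conversely, states are the complexifications of the real functionals `g` with `g 1 = 1` that are
nonnegative on the accretive elements, those with positive real part. Riesz's extension theorem
makes such a `g` nonnegative on a further cone `C`, provided no element of `C` has real part below
a negative scalar. Take for `C` the sum of `⟨e | K⟩` and the real line through `⟨e | e⟩ - ‖e‖ ^ 2`.
If `ℜ ⟨e | f⟩ + t (⟨e | e⟩ - ‖e‖ ^ 2) ≤ r`, then substituting this in
`⟨e + k f | e + k f⟩ = ⟨e | e⟩ + 2 k ℜ ⟨e | f⟩ + k ^ 2 ⟨f | f⟩` yields, for small `k > 0`,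
`‖e + k f‖ ^ 2 ≤ ‖e‖ ^ 2 + 2 k r + k ^ 2 ‖f‖ ^ 2`. Orthogonality makes the left side at least
`‖e‖ ^ 2`; dividing by `k` and letting `k → 0` gives `0 ≤ r`.
-/

open scoped ComplexStarModule Topology

theorem forall_mem_re_nonneg_iff_forall_mem_eq_zero {𝕜 V : Type*} [RCLike 𝕜] [AddCommGroup V]
    [Module 𝕜 V] (ψ : V →ₗ[𝕜] 𝕜) (W : Submodule 𝕜 V) :
    (∀ w ∈ W, 0 ≤ RCLike.re (ψ w)) ↔ ∀ w ∈ W, ψ w = 0 := by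
  refine ⟨fun h w hw ↦ ?_, fun h w hw ↦ by simp [h w hw]⟩
  have h_rotated := h _ (W.smul_mem (-star (ψ w)) hw)
  rw [map_smul, smul_eq_mul, neg_mul, RCLike.star_def, RCLike.conj_mul, ← RCLike.ofReal_pow,
    ← RCLike.ofReal_neg, RCLike.ofReal_re, neg_nonneg] at h_rotated
  exact norm_eq_zero.1 (pow_eq_zero_iff two_ne_zero |>.1 (le_antisymm h_rotated (sq_nonneg _)))

theorem isBirkhoffJamesOrthogonalTo_iff_forall_norm_le_norm_add {𝕜 V : Type*} [NormedField 𝕜]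
    [NormedAddCommGroup V] [NormedSpace 𝕜 V] {v : V} {W : Submodule 𝕜 V} :
    IsBirkhoffJamesOrthogonalTo v W ↔ ∀ w ∈ W, ‖v‖ ≤ ‖v + w‖ :=
  ⟨fun h w hw ↦ by simpa only [one_smul] using h w hw 1,
    fun h w hw k ↦ h (k • w) (W.smul_mem k hw)⟩

theorem exists_linearMap_eq_one_forall_mem_nonneg {V : Type*} [AddCommGroup V] [Module ℝ V]
    (s : PointedCone ℝ V) (u : V) (exists_smul_add_mem : ∀ v, ∃ r : ℝ, r • u + v ∈ s)
    (nonneg_of_smul_mem : ∀ r : ℝ, r • u ∈ s → 0 ≤ r) :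
    ∃ g : V →ₗ[ℝ] ℝ, g u = 1 ∧ ∀ v ∈ s, 0 ≤ g v := by
  have u_ne_zero : u ≠ 0 := by
    rintro rfl
    exact absurd (nonneg_of_smul_mem (-1) (by simp)) (by norm_num)
  let coord : V →ₗ.[ℝ] ℝ := LinearPMap.mkSpanSingleton u 1 u_ne_zero
  have smul_mem (r : ℝ) : r • u ∈ coord.domain := Submodule.mem_span_singleton.2 ⟨r, rfl⟩
  have coord_smul (r : ℝ) : coord ⟨r • u, smul_mem r⟩ = r :=
    (LinearPMap.mkSpanSingleton'_apply u (1 : ℝ) _ r (smul_mem r)).trans (mul_one r)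
  obtain ⟨g, g_eq_coord, g_nonneg⟩ := riesz_extension s coord
    (by
      rintro ⟨x, hx⟩ hxs
      obtain ⟨r, rfl⟩ := Submodule.mem_span_singleton.1 hx
      exact (nonneg_of_smul_mem r hxs).trans_eq (coord_smul r).symm)
    (fun v ↦ (exists_smul_add_mem v).imp' (fun r ↦ ⟨r • u, smul_mem r⟩) fun _ h ↦ h)
  refine ⟨g, ?_, g_nonneg⟩
  simpa only [one_smul] using (g_eq_coord ⟨(1 : ℝ) • u, smul_mem 1⟩).trans (coord_smul 1)

section State

variable {A : Type*} [CStarAlgebra A] [PartialOrder A]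

theorem stateSet.map_algebraMap {φ : A →ₗ[ℂ] ℂ} (hφ : φ ∈ stateSet A) (r : ℝ) :
    φ (algebraMap ℝ A r) = r := by
  rw [Algebra.algebraMap_eq_smul_one, ← Complex.coe_smul, map_smul, hφ.1, smul_eq_mul, mul_one]

variable [StarOrderedRing A]

theorem norm_le_iff_le_algebraMap_of_nonneg [Nontrivial A] {a : A} (ha : 0 ≤ a) {r : ℝ} :
    ‖a‖ ≤ r ↔ a ≤ algebraMap ℝ A r := by
  refine ⟨fun h ↦ (CStarAlgebra.norm_le_iff_le_algebraMap a ((norm_nonneg a).trans h)).1 h,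
    fun h ↦ ?_⟩
  have hr : 0 ≤ r := by
    rw [← algebraMap_le_algebraMap (β := A), map_zero]
    exact ha.trans h
  exact (CStarAlgebra.norm_le_iff_le_algebraMap a hr).2 h

theorem stateSet.re_mono {φ : A →ₗ[ℂ] ℂ} (hφ : φ ∈ stateSet A) {a b : A} (hab : a ≤ b) :
    (φ a).re ≤ (φ b).re :=
  (Complex.le_def.1 ((PositiveLinearMap.mk₀ φ hφ.2).monotone' hab)).1

theorem stateSet.map_realPart {φ : A →ₗ[ℂ] ℂ} (hφ : φ ∈ stateSet A) (a : A) :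
    φ (ℜ a) = (φ a).re :=
  (_root_.map_realPart (PositiveLinearMap.mk₀ φ hφ.2) a).trans (Complex.coe_realPart _)

variable (A) in
/-- The cone of accretive elements of a C⋆-algebra, that is, of those with positive real part. The
functionals that are nonnegative on it are the real parts of the positive functionals. -/
noncomputable def accretiveCone : PointedCone ℝ A :=
  (PointedCone.positive ℝ A).comap ((selfAdjoint.submodule ℝ A).subtype ∘ₗ realPart)

theorem mem_accretiveCone {a : A} : a ∈ accretiveCone A ↔ 0 ≤ (ℜ a : A) :=
  Iff.rfl

theorem exists_mem_stateSet_forall_re_eq {g : Module.Dual ℝ A} (g_one : g 1 = 1)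
    (g_nonneg : ∀ a ∈ accretiveCone A, 0 ≤ g a) :
    ∃ φ ∈ stateSet A, ∀ a, (φ a).re = g a := by
  have g_I_smul {a : A} (ha : IsSelfAdjoint a) : g (Complex.I • a) = 0 := by
    have h_real : ℜ (Complex.I • a) = 0 := by rw [realPart_I_smul, ha.imaginaryPart, neg_zero]
    have h_pos := g_nonneg _ (mem_accretiveCone.2 (congrArg Subtype.val h_real).ge)
    have h_neg := g_nonneg (-(Complex.I • a)) (by simp [mem_accretiveCone, h_real])
    rw [map_neg] at h_neg
    linarith
  have re_apply (a : A) : (g.extendRCLike a : ℂ).re = g a :=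
    Module.Dual.re_extendRCLike_apply (𝕜 := ℂ) g a
  have apply_of_isSelfAdjoint {a : A} (ha : IsSelfAdjoint a) : (g.extendRCLike a : ℂ) = g a := by
    rw [Module.Dual.extendRCLike_apply]
    simp [g_I_smul ha]
  refine ⟨g.extendRCLike, ⟨?_, fun a ha ↦ ?_⟩, re_apply⟩
  · rw [apply_of_isSelfAdjoint (.one A), g_one, Complex.ofReal_one]
  · rw [apply_of_isSelfAdjoint (.of_nonneg ha), Complex.zero_le_real]
    exact g_nonneg a (mem_accretiveCone.2 (realPart_nonneg_of_nonneg ha))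

theorem exists_mem_stateSet_forall_mem_re_nonneg (C : PointedCone ℝ A)
    (hC : ∀ c ∈ C, ∀ r : ℝ, (ℜ c : A) ≤ algebraMap ℝ A r → 0 ≤ r) :
    ∃ φ ∈ stateSet A, ∀ c ∈ C, 0 ≤ (φ c).re := by
  have realPart_smul_one_add (r : ℝ) (a : A) :
      (ℜ (r • 1 + a) : A) = algebraMap ℝ A r + ℜ a := by
    simp [Algebra.algebraMap_eq_smul_one]
  have exists_smul_one_add_mem (a : A) : ∃ r : ℝ, r • 1 + a ∈ accretiveCone A ⊔ C := by
    refine ⟨‖(ℜ a : A)‖, Submodule.mem_sup_left (mem_accretiveCone.2 ?_)⟩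
    rw [realPart_smul_one_add, ← neg_le_iff_add_nonneg']
    exact (ℜ a).2.neg_algebraMap_norm_le_self
  have nonneg_of_smul_one_mem (r : ℝ) (hr : r • (1 : A) ∈ accretiveCone A ⊔ C) : 0 ≤ r := by
    obtain ⟨a, ha, c, hc, hac⟩ := Submodule.mem_sup.1 hr
    refine hC c hc r (sub_nonneg.1 ?_)
    have h_real : (ℜ a : A) = algebraMap ℝ A r - ℜ c := by
      rw [eq_sub_of_add_eq hac, sub_eq_add_neg, realPart_smul_one_add, map_neg,
        AddSubgroup.coe_neg, ← sub_eq_add_neg]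
    exact h_real ▸ mem_accretiveCone.1 ha
  obtain ⟨g, g_one, g_nonneg⟩ := exists_linearMap_eq_one_forall_mem_nonneg
    (accretiveCone A ⊔ C) 1 exists_smul_one_add_mem nonneg_of_smul_one_mem
  obtain ⟨φ, hφ, re_φ⟩ := exists_mem_stateSet_forall_re_eq g_one fun a ha ↦
    g_nonneg a (Submodule.mem_sup_left ha)
  exact ⟨φ, hφ, fun c hc ↦ (g_nonneg c (Submodule.mem_sup_right hc)).trans_eq (re_φ c).symm⟩

end State

section RightInner

variable {A E : Type*} [NonUnitalCStarAlgebra A] [PartialOrder A] [AddCommGroup E] [Module ℂ E]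
  [Norm E] [SMul Aᵐᵒᵖ E] [CStarModule Aᵐᵒᵖ E]

variable (A) in
/-- The `A`-valued inner product `⟨x | ·⟩` as a linear map in its second variable. -/
def rightInnerₗ (x : E) : E →ₗ[ℂ] A :=
  (MulOpposite.opLinearEquiv ℂ).symm.toLinearMap ∘ₗ CStarModule.innerₛₗ x

theorem star_rightInner (x y : E) : star (rightInner A x y) = rightInner A y x :=
  congrArg MulOpposite.unop (CStarModule.star_inner x y)

theorem rightInner_self_nonneg (x : E) : 0 ≤ rightInner A x x :=
  CStarModule.inner_self_nonneg (A := Aᵐᵒᵖ)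

theorem norm_rightInner_self (x : E) : ‖rightInner A x x‖ = ‖x‖ ^ 2 :=
  (CStarModule.norm_sq_eq Aᵐᵒᵖ).symm

theorem rightInner_add_self (x y : E) :
    rightInner A (x + y) (x + y) =
      rightInner A x x + (2 : ℝ) • (ℜ (rightInner A x y) : A) + rightInner A y y := by
  rw [realPart_apply_coe, smul_inv_smul₀ two_ne_zero, star_rightInner]
  simp only [rightInner, CStarModule.inner_add_left, CStarModule.inner_add_right,
    MulOpposite.unop_add]
  abel

end RightInner

section StateRightInner

variable {A E : Type*} [CStarAlgebra A] [PartialOrder A]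

section

variable [AddCommGroup E] [Module ℂ E] [Norm E] [SMul Aᵐᵒᵖ E] [CStarModule Aᵐᵒᵖ E]

variable (A) in
/-- The cone generated by the elements `⟨e | f⟩` for `f ∈ K` and by `± (⟨e | e⟩ - ‖e‖ ^ 2)`. A
state whose real part is nonnegative on it has `φ ⟨e | e⟩ = ‖e‖ ^ 2` and `0 ≤ re (φ ⟨e | f⟩)`. -/
noncomputable def birkhoffJamesCone (e : E) (K : PointedCone ℝ E) : PointedCone ℝ A :=
  K.map ((rightInnerₗ A e).restrictScalars ℝ) ⊔
    (Submodule.span ℝ {rightInner A e e - algebraMap ℝ A (‖e‖ ^ 2)} : Submodule ℝ A)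

theorem stateSet.apply_rightInner_self_eq_norm_sq {φ : A →ₗ[ℂ] ℂ}
    (hφ : φ ∈ stateSet A) {e : E} {K : PointedCone ℝ E}
    (h : ∀ c ∈ birkhoffJamesCone A e K, 0 ≤ (φ c).re) :
    φ (rightInner A e e) = ((‖e‖ ^ 2 : ℝ) : ℂ) := by
  have mem_cone : ∀ c ∈ Submodule.span ℝ {rightInner A e e - algebraMap ℝ A (‖e‖ ^ 2)},
      c ∈ birkhoffJamesCone A e K := fun _ hc ↦ Submodule.mem_sup_right hc
  have h_le := h _ (mem_cone _ (neg_mem (Submodule.mem_span_singleton_self _)))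
  have h_ge := h _ (mem_cone _ (Submodule.mem_span_singleton_self _))
  rw [map_neg, map_sub, stateSet.map_algebraMap hφ, Complex.neg_re, Complex.sub_re,
    Complex.ofReal_re] at h_le
  rw [map_sub, stateSet.map_algebraMap hφ, Complex.sub_re, Complex.ofReal_re] at h_ge
  have h_im := (Complex.le_def.1 (hφ.2 _ (rightInner_self_nonneg e))).2
  refine Complex.ext ?_ h_im.symm
  rw [Complex.ofReal_re]
  linarith

variable [StarOrderedRing A]

theorem rightInner_self_le_algebraMap_norm_sq (x : E) :
    rightInner A x x ≤ algebraMap ℝ A (‖x‖ ^ 2) :=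
  norm_rightInner_self (A := A) x ▸
    IsSelfAdjoint.le_algebraMap_norm_self (.of_nonneg (rightInner_self_nonneg x))

theorem norm_sq_le_iff_rightInner_self_le_algebraMap [Nontrivial A] {x : E} {r : ℝ} :
    ‖x‖ ^ 2 ≤ r ↔ rightInner A x x ≤ algebraMap ℝ A r := by
  rw [← norm_rightInner_self (A := A),
    norm_le_iff_le_algebraMap_of_nonneg (rightInner_self_nonneg x)]

theorem stateSet.re_rightInner_self_le_norm_sq {φ : A →ₗ[ℂ] ℂ} (hφ : φ ∈ stateSet A) (x : E) :
    (φ (rightInner A x x)).re ≤ ‖x‖ ^ 2 := by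
  simpa only [stateSet.map_algebraMap hφ, Complex.ofReal_re] using
    stateSet.re_mono hφ (rightInner_self_le_algebraMap_norm_sq x)

theorem stateSet.re_rightInner_add_self {φ : A →ₗ[ℂ] ℂ} (hφ : φ ∈ stateSet A) (x y : E) :
    (φ (rightInner A (x + y) (x + y))).re = (φ (rightInner A x x)).re +
      2 * (φ (rightInner A x y)).re + (φ (rightInner A y y)).re := by
  rw [rightInner_add_self, map_add, map_add, ← Complex.coe_smul, map_smul,
    stateSet.map_realPart hφ]
  simp only [Complex.add_re, smul_eq_mul, Complex.re_ofReal_mul, Complex.ofReal_re]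

end

variable [StarOrderedRing A] [NormedAddCommGroup E] [NormedSpace ℂ E] [SMul Aᵐᵒᵖ E]
  [CStarModule Aᵐᵒᵖ E]

theorem norm_le_norm_add_of_mem_stateSet {φ : A →ₗ[ℂ] ℂ} (hφ : φ ∈ stateSet A) {e f : E}
    (he : φ (rightInner A e e) = ((‖e‖ ^ 2 : ℝ) : ℂ)) (hf : 0 ≤ (φ (rightInner A e f)).re) :
    ‖e‖ ≤ ‖e + f‖ := by
  have hff : 0 ≤ (φ (rightInner A f f)).re :=
    (Complex.le_def.1 (hφ.2 _ (rightInner_self_nonneg f))).1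
  refine le_of_sq_le_sq ?_ (norm_nonneg _)
  calc ‖e‖ ^ 2 = (φ (rightInner A e e)).re := by rw [he, Complex.ofReal_re]
    _ ≤ (φ (rightInner A (e + f) (e + f))).re := by
      rw [stateSet.re_rightInner_add_self hφ]
      linarith
    _ ≤ ‖e + f‖ ^ 2 := stateSet.re_rightInner_self_le_norm_sq hφ _

variable [Nontrivial A]

theorem norm_add_smul_sq_le_of_realPart_rightInner_le {e f : E} {t r k : ℝ}
    (h : (ℜ (rightInner A e f) : A) + t • (rightInner A e e - algebraMap ℝ A (‖e‖ ^ 2)) ≤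
      algebraMap ℝ A r) (hk : 0 ≤ k) (hkt : 2 * k * t ≤ 1) :
    ‖e + k • f‖ ^ 2 ≤ ‖e‖ ^ 2 + 2 * k * r + k ^ 2 * ‖f‖ ^ 2 := by
  set p := rightInner A e e
  have he : p ≤ algebraMap ℝ A (‖e‖ ^ 2) := rightInner_self_le_algebraMap_norm_sq e
  have hkf : rightInner A (k • f) (k • f) ≤ algebraMap ℝ A (k ^ 2 * ‖f‖ ^ 2) := by
    simpa only [norm_smul, mul_pow, Real.norm_eq_abs, sq_abs] using
      rightInner_self_le_algebraMap_norm_sq (A := A) (k • f)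
  have rightInner_smul : rightInner A e (k • f) = k • rightInner A e f :=
    (rightInnerₗ A e).map_smul_of_tower k f
  refine (norm_sq_le_iff_rightInner_self_le_algebraMap (A := A)).2 ?_
  calc rightInner A (e + k • f) (e + k • f)
      = (1 - 2 * k * t) • p + (2 * k * t) • algebraMap ℝ A (‖e‖ ^ 2)
          + (2 * k) • ((ℜ (rightInner A e f) : A) + t • (p - algebraMap ℝ A (‖e‖ ^ 2)))
          + rightInner A (k • f) (k • f) := by
        rw [rightInner_add_self, rightInner_smul, map_smul, selfAdjoint.val_smul]
        module
    _ ≤ (1 - 2 * k * t) • algebraMap ℝ A (‖e‖ ^ 2) + (2 * k * t) • algebraMap ℝ A (‖e‖ ^ 2)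
          + (2 * k) • algebraMap ℝ A r + algebraMap ℝ A (k ^ 2 * ‖f‖ ^ 2) := by
        have := sub_nonneg.2 hkt
        gcongr
    _ = algebraMap ℝ A (‖e‖ ^ 2 + 2 * k * r + k ^ 2 * ‖f‖ ^ 2) := by
        simp only [Algebra.algebraMap_eq_smul_one]
        module

theorem nonneg_of_realPart_rightInner_le {e f : E} {t r : ℝ}
    (h_norm : ∀ k : ℝ, 0 ≤ k → ‖e‖ ≤ ‖e + k • f‖)
    (h : (ℜ (rightInner A e f) : A) + t • (rightInner A e e - algebraMap ℝ A (‖e‖ ^ 2)) ≤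
      algebraMap ℝ A r) : 0 ≤ r := by
  have difference_quotient_nonneg {k : ℝ} (hk : 0 < k) (hkt : 2 * k * t ≤ 1) :
      0 ≤ 2 * r + k * ‖f‖ ^ 2 := by
    have h_sq := pow_le_pow_left₀ (norm_nonneg e) (h_norm k hk.le) 2
    have h_expand := norm_add_smul_sq_le_of_realPart_rightInner_le h hk.le hkt
    refine nonneg_of_mul_nonneg_right ?_ hk
    linarith
  have h_small : ∀ᶠ k in 𝓝[>] (0 : ℝ), 2 * k * t ≤ 1 := by
    have h_lim : Filter.Tendsto (fun k : ℝ ↦ 2 * k * t) (𝓝[>] 0) (𝓝 (2 * 0 * t)) :=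
      Continuous.tendsto (by fun_prop) 0 |>.mono_left nhdsWithin_le_nhds
    exact h_lim.eventually_le_const (by norm_num)
  have h_lim : Filter.Tendsto (fun k : ℝ ↦ 2 * r + k * ‖f‖ ^ 2) (𝓝[>] 0)
      (𝓝 (2 * r + 0 * ‖f‖ ^ 2)) :=
    Continuous.tendsto (by fun_prop) 0 |>.mono_left nhdsWithin_le_nhds
  have h_two_mul := ge_of_tendsto h_lim <| by
    filter_upwards [self_mem_nhdsWithin, h_small] with k hk hkt
    exact difference_quotient_nonneg hk hkt
  linarith

theorem nonneg_of_mem_birkhoffJamesCone {e : E} {K : PointedCone ℝ E}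
    (h_norm : ∀ f ∈ K, ‖e‖ ≤ ‖e + f‖) {c : A} (hc : c ∈ birkhoffJamesCone A e K) {r : ℝ}
    (h : (ℜ c : A) ≤ algebraMap ℝ A r) : 0 ≤ r := by
  obtain ⟨_, ⟨f, hf, rfl⟩, _, h_line, rfl⟩ := Submodule.mem_sup.1 hc
  obtain ⟨t, rfl⟩ := Submodule.mem_span_singleton.1 h_line
  have h_selfAdjoint : IsSelfAdjoint (rightInner A e e - algebraMap ℝ A (‖e‖ ^ 2)) :=
    .sub (star_rightInner e e) (.algebraMap A (.all _))
  refine nonneg_of_realPart_rightInner_le (A := A) (t := t)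
    (fun k hk ↦ h_norm _ (K.smul_mem hk hf)) ?_
  rwa [map_add, map_smul, AddSubgroup.coe_add, selfAdjoint.val_smul,
    h_selfAdjoint.coe_realPart] at h

theorem exists_mem_stateSet_of_forall_norm_le_norm_add {e : E} {K : PointedCone ℝ E}
    (h : ∀ f ∈ K, ‖e‖ ≤ ‖e + f‖) :
    ∃ φ ∈ stateSet A, φ (rightInner A e e) = ((‖e‖ ^ 2 : ℝ) : ℂ) ∧
      ∀ f ∈ K, 0 ≤ (φ (rightInner A e f)).re := by
  obtain ⟨φ, hφ, re_nonneg⟩ := exists_mem_stateSet_forall_mem_re_nonneg (birkhoffJamesCone A e K)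
    fun _ hc _ ↦ nonneg_of_mem_birkhoffJamesCone h hc
  exact ⟨φ, hφ, stateSet.apply_rightInner_self_eq_norm_sq hφ re_nonneg,
    fun f hf ↦ re_nonneg _ (Submodule.mem_sup_left ⟨f, hf, rfl⟩)⟩

variable (A) in
theorem forall_mem_norm_le_norm_add_iff_exists_mem_stateSet (e : E) (K : PointedCone ℝ E) :
    (∀ f ∈ K, ‖e‖ ≤ ‖e + f‖) ↔
      ∃ φ ∈ stateSet A, φ (rightInner A e e) = ((‖e‖ ^ 2 : ℝ) : ℂ) ∧
        ∀ f ∈ K, 0 ≤ (φ (rightInner A e f)).re :=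
  ⟨exists_mem_stateSet_of_forall_norm_le_norm_add,
    fun ⟨_, hφ, he, hK⟩ f hf ↦ norm_le_norm_add_of_mem_stateSet hφ he (hK f hf)⟩

theorem mainTheorem7_general (e : E) (F : Submodule ℂ E) :
    IsBirkhoffJamesOrthogonalTo e F ↔
      ∃ φ ∈ stateSet A,
        φ (rightInner A e e) = ((‖e‖ ^ 2 : ℝ) : ℂ) ∧ ∀ f ∈ F, φ (rightInner A e f) = 0 := by
  calc IsBirkhoffJamesOrthogonalTo e F
    _ ↔ ∀ f ∈ F, ‖e‖ ≤ ‖e + f‖ := isBirkhoffJamesOrthogonalTo_iff_forall_norm_le_norm_add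
    _ ↔ ∃ φ ∈ stateSet A, φ (rightInner A e e) = ((‖e‖ ^ 2 : ℝ) : ℂ) ∧
          ∀ f ∈ F, 0 ≤ (φ (rightInner A e f)).re :=
      forall_mem_norm_le_norm_add_iff_exists_mem_stateSet A e (F.restrictScalars ℝ : Submodule ℝ E)
    _ ↔ _ := by
      refine exists_congr fun φ ↦ and_congr_right fun _ ↦ and_congr_right fun _ ↦ ?_
      exact forall_mem_re_nonneg_iff_forall_mem_eq_zero (φ ∘ₗ rightInnerₗ A e) F

end StateRightInner

theorem mainTheorem7 {A E : Type*}
    [CStarAlgebra A] [Nontrivial A] [PartialOrder A] [StarOrderedRing A]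
    [NormedAddCommGroup E] [NormedSpace ℂ E] [CompleteSpace E]
    [Module Aᵐᵒᵖ E] [CStarModule Aᵐᵒᵖ E]
    (e : E) (F : Submodule ℂ E) :
    IsBirkhoffJamesOrthogonalTo e F ↔
      ∃ φ ∈ stateSet A,
        φ (rightInner A e e) = ((‖e‖ ^ 2 : ℝ) : ℂ) ∧ ∀ f ∈ F, φ (rightInner A e f) = 0 :=
  mainTheorem7_general e F
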